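/- Let $n\in\mathbb Z_{>0}$, $k\in\mathbb Z_{\ge 0}$, and let $V$ be a complex vector space with basis $v_1,\dots,v_n$. Let $A_k$ be the set of set partitions $d$ of $\{1,\dots,k,1',\dots,k'\}$, and $A_{k+\frac12}\subseteq A_{k+1}$ the set of those in which $k+1$ and $(k+1)'$ lie in the same block. For $d_1,d_2\in A_k$ let $d_1\circ d_2\in A_k$ be obtained by placing $d_1$ (top row $1,\dots,k$, bottom row $1',\dots,k'$) above $d_2$, identifying the bottom row of $d_1$ with the top row of $d_2$, and forgetting the middle row; let $\ell$ be the number of connected components that lie entirely in the middle row. The partition algebra $\mathbb CA_k(n)$ is the associative algebra with basis $A_k$ and product $d_1d_2=n^{\ell}(d_1\circ d_2)$, and $\mathbb CA_{k+\frac12}(n)\subseteq\mathbb CA_{k+1}(n)$ is the subalgebra spanned by $A_{k+\frac12}$. The elements $x_d$ ($d\in A_k$) of $\mathbb CA_k(n)$ are determined by $$d=\sum_{d'\ge d}x_{d'}\quad(d\in A_k),$$ where $d'\ge d$ means that $d'$ is coarser than or equal to $d$. For $d\in A_{k+\frac12}$, the element $x_d$ of $\mathbb CA_{k+1}(n)$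 lies in $\mathbb CA_{k+\frac12}(n)$. Let $\Phi_k:\mathbb CA_k(n)\to\mathrm{End}(V^{\otimes k})$ be the linear map with $$\Phi_k(d)(v_{i_1}\otimes\cdots\otimes v_{i_k})=\sum_{1\le i_{1'},\dots,i_{k'}\le n}(d)^{i_1,\dots,i_k}_{i_{1'},\dots,i_{k'}}\,v_{i_{1'}}\otimes\cdots\otimes v_{i_{k'}}\qquad(d\in A_k),$$ where $(d)^{i_1,\dots,i_k}_{i_{1'},\dots,i_{k'}}$ is $1$ if $i_r=i_s$ whenever $r$ and $s$ are in the same block of $d$, and $0$ otherwise; it is a right action, that is, an algebra homomorphism $\mathbb CA_k(n)\to\mathrm{End}(V^{\otimes k})^{\mathrm{op}}$. Let $\Phi_{k+\frac12}:\mathbb CA_{k+\frac12}(n)\to\mathrm{End}(V^{\otimes k})$ be the action obtained from $\Phi_{k+1}$ by restricting to the stable subspace $V^{\otimes k}\otimes v_n\subseteq V^{\otimes(k+1)}$ and identifying it with $V^{\otimes k}$. Let $S_n$ act on $V^{\otimes k}$ by $\sigma(v_{i_1}\otimes\cdots\otimes v_{i_k})=v_{\sigma(i_1)}\otimes\cdots\otimes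 v_{\sigma(i_k)}$, let $S_{n-1}\subseteq S_n$ be the stabilizer of $n$, and for a subgroup $G\subseteq S_n$ let $\mathrm{End}_G(V^{\otimes k})$ be the algebra of endomorphisms that commute with the action of $G$. Then: (a) $\operatorname{im}\Phi_k=\mathrm{End}_{S_n}(V^{\otimes k})$ and $\ker\Phi_k=\mathbb C\text{-span}\{x_d\mid d\in A_k,\ d\text{ has more than }n\text{ blocks}\}$; (b) $\operatorname{im}\Phi_{k+\frac12}=\mathrm{End}_{S_{n-1}}(V^{\otimes k})$ and $\ker\Phi_{k+\frac12}=\mathbb C\text{-span}\{x_d\mid d\in A_{k+\frac12},\ d\text{ has more than }n\text{ blocks}\}$. -/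

import Mathlib

open scoped TensorProduct

noncomputable section

namespace PartAlg

/-! ### Set partitions and their composition -/

/-- The set `A_k` of set partitions of `{1, …, k, 1', …, k'}`, given as equivalence relations;
`Sum.inl i` is the top vertex `i` and `Sum.inr i` the bottom vertex `i'`.  The blocks are the
equivalence classes, and `d₁ ≤ d₂` means that `d₂` is coarser than `d₁`. -/
abbrev Diagram (k : ℕ) : Type := Setoid (Fin k ⊕ Fin k)

/-- The number of blocks of a set partition. -/
def Diagram.numBlocks {k : ℕ} (d : Diagram k) : ℕ := Nat.card (Quotient d)

/-- The vertices of the upper diagram among the three rows (top, middle, bottom). -/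
def upper {k : ℕ} : Fin k ⊕ Fin k → Fin k ⊕ (Fin k ⊕ Fin k) := Sum.elim Sum.inl (Sum.inr ∘ Sum.inl)

/-- The vertices of the lower diagram among the three rows (top, middle, bottom). -/
def lower {k : ℕ} : Fin k ⊕ Fin k → Fin k ⊕ (Fin k ⊕ Fin k) := Sum.inr

/-- The vertices of the top and of the bottom row among the three rows. -/
def outer {k : ℕ} : Fin k ⊕ Fin k → Fin k ⊕ (Fin k ⊕ Fin k) := Sum.elim Sum.inl (Sum.inr ∘ Sum.inr)

/-- Connected components of the three-row graph obtained by placing `d₁` above `d₂` and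
identifying the bottom row of `d₁` with the top row of `d₂`. -/
def stack {k : ℕ} (d₁ d₂ : Diagram k) : Setoid (Fin k ⊕ (Fin k ⊕ Fin k)) :=
  Relation.EqvGen.setoid fun a b =>
    (∃ x y, d₁ x y ∧ upper x = a ∧ upper y = b) ∨ (∃ x y, d₂ x y ∧ lower x = a ∧ lower y = b)

/-- The composition `d₁ ∘ d₂`: stack `d₁` above `d₂` and forget the middle row. -/
def comp {k : ℕ} (d₁ d₂ : Diagram k) : Diagram k := (stack d₁ d₂).comap outer

/-- The components of the stacked graph that live entirely in the middle row. -/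
abbrev Removed {k : ℕ} (d₁ d₂ : Diagram k) : Type :=
  {q : Quotient (stack d₁ d₂) // ∀ x, Quotient.mk (stack d₁ d₂) (outer x) ≠ q}

/-- The number `ℓ` of blocks removed from the middle row when composing. -/
def numRemoved {k : ℕ} (d₁ d₂ : Diagram k) : ℕ := Nat.card (Removed d₁ d₂)

/-- The identity diagram, with blocks `{i, i'}`. -/
def idDiagram (k : ℕ) : Diagram k := Setoid.ker (Sum.elim id id)

/-- A labelling of the vertices, `i` on the top and `i'` on the bottom row, respects `d` if
vertices in the same block carry the same label. -/
def Respects {k : ℕ} {α : Type*} (d : Diagram k) (i i' : Fin k → α) : Prop :=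
  ∀ r s, d r s → Sum.elim i i' r = Sum.elim i i' s

lemma respects_iff_stack {k : ℕ} {α : Type*} (d₁ d₂ : Diagram k) (i j i' : Fin k → α) :
    Respects d₁ i j ∧ Respects d₂ j i' ↔
      ∀ a b, stack d₁ d₂ a b → Sum.elim i (Sum.elim j i') a = Sum.elim i (Sum.elim j i') b := by
  have hu : ∀ x, Sum.elim i (Sum.elim j i') (upper x) = Sum.elim i j x := by
    rintro (x | x) <;> rfl
  constructor
  · rintro ⟨h₁, h₂⟩ a b hab
    have : stack d₁ d₂ ≤ Setoid.ker (Sum.elim i (Sum.elim j i')) := by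
      apply Setoid.eqvGen_le
      rintro _ _ (⟨x, y, h, rfl, rfl⟩ | ⟨x, y, h, rfl, rfl⟩)
      · change Sum.elim i (Sum.elim j i') (upper x) = Sum.elim i (Sum.elim j i') (upper y)
        rw [hu, hu]; exact h₁ x y h
      · exact h₂ x y h
    exact this hab
  · intro h
    refine ⟨fun r s hrs => ?_, fun r s hrs => ?_⟩
    · rw [← hu, ← hu]
      exact h _ _ (Relation.EqvGen.rel _ _ (Or.inl ⟨r, s, hrs, rfl, rfl⟩))
    · exact h _ _ (Relation.EqvGen.rel _ _ (Or.inr ⟨r, s, hrs, rfl, rfl⟩))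

lemma elim_outer {k : ℕ} {α : Type*} (i j i' : Fin k → α) (x : Fin k ⊕ Fin k) :
    Sum.elim i (Sum.elim j i') (outer x) = Sum.elim i i' x := by
  cases x <;> rfl

lemma respects_comp {k : ℕ} {α : Type*} {d₁ d₂ : Diagram k} {i j i' : Fin k → α}
    (h : Respects d₁ i j ∧ Respects d₂ j i') : Respects (comp d₁ d₂) i i' := by
  intro r s hrs
  rw [← elim_outer i j i', ← elim_outer i j i']
  exact (respects_iff_stack _ _ _ _ _).1 h _ _ hrs

open Classical in
/-- Labellings of the middle row that are compatible with a given admissible labelling of the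
outer rows are the same as arbitrary labellings of the removed blocks. -/
def middleEquiv {k : ℕ} {α : Type*} (d₁ d₂ : Diagram k) (i i' : Fin k → α)
    (h : Respects (comp d₁ d₂) i i') :
    {j : Fin k → α // Respects d₁ i j ∧ Respects d₂ j i'} ≃ (Removed d₁ d₂ → α) where
  toFun j q := Quotient.lift (Sum.elim i (Sum.elim j.1 i'))
    ((respects_iff_stack _ _ _ _ _).1 j.2) q.1
  invFun g :=
    let F : Quotient (stack d₁ d₂) → α := fun q =>
      if hq : ∀ x, Quotient.mk (stack d₁ d₂) (outer x) ≠ q then g ⟨q, hq⟩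
      else Sum.elim i i' (Classical.choose (Classical.not_forall_not.1 hq))
    have hF : ∀ x, F (Quotient.mk _ (outer x)) = Sum.elim i i' x := by
      intro x
      have hx : ¬ ∀ y, Quotient.mk (stack d₁ d₂) (outer y) ≠ Quotient.mk _ (outer x) :=
        fun h => h x rfl
      simp only [F, dif_neg hx]
      exact h _ _ (Quotient.exact (s := stack d₁ d₂)
        (Classical.choose_spec (Classical.not_forall_not.1 hx)))
    ⟨fun m => F (Quotient.mk _ (Sum.inr (Sum.inl m))), by
      rw [respects_iff_stack]
      have : ∀ a, Sum.elim i (Sum.elim (fun m => F (Quotient.mk _ (Sum.inr (Sum.inl m)))) i') a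
          = F (Quotient.mk _ a) := by
        rintro (a | a | a)
        · exact (hF (Sum.inl a)).symm
        · rfl
        · exact (hF (Sum.inr a)).symm
      intro a b hab
      rw [this, this, Quotient.sound hab]⟩
  left_inv j := by
    apply Subtype.ext
    funext m
    dsimp only
    split_ifs with hq
    · rfl
    · have := Classical.choose_spec (Classical.not_forall_not.1 hq)
      rw [← elim_outer i j.1 i']
      exact (respects_iff_stack _ _ _ _ _).1 j.2 _ _ (Quotient.exact this)
  right_inv g := by
    funext ⟨q, hq⟩
    induction q using Quotient.inductionOn with
    | _ a =>
      rcases a with a | a | a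
      · exact absurd rfl (hq (Sum.inl a))
      · simp only [Quotient.lift_mk, Sum.elim_inr, Sum.elim_inl]
        rw [dif_pos hq]
      · exact absurd rfl (hq (Sum.inr a))

open Classical in
/-- The number of compatible labellings of the middle row. -/
lemma card_middle {k : ℕ} {α : Type*} [Finite α] (d₁ d₂ : Diagram k) (i i' : Fin k → α) :
    Nat.card {j : Fin k → α // Respects d₁ i j ∧ Respects d₂ j i'} =
      Nat.card α ^ numRemoved d₁ d₂ * if Respects (comp d₁ d₂) i i' then 1 else 0 := by
  split_ifs with h
  · rw [Nat.card_congr (middleEquiv d₁ d₂ i i' h), mul_one, Nat.card_fun]; rfl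
  · have : IsEmpty {j : Fin k → α // Respects d₁ i j ∧ Respects d₂ j i'} :=
      ⟨fun j => h (respects_comp j.2)⟩
    simp

open Classical in
lemma sum_middle {k : ℕ} {α : Type*} [Fintype α] (d₁ d₂ : Diagram k) (i i' : Fin k → α) :
    (∑ j : Fin k → α, (if Respects d₁ i j then 1 else 0) * (if Respects d₂ j i' then 1 else 0)) =
      Fintype.card α ^ numRemoved d₁ d₂ * if Respects (comp d₁ d₂) i i' then 1 else 0 := by
  rw [← Nat.card_eq_fintype_card, ← card_middle, Nat.card_eq_fintype_card, Fintype.card_subtype,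
    Finset.card_filter]
  refine Finset.sum_congr rfl fun j _ => ?_
  by_cases h₁ : Respects d₁ i j <;> by_cases h₂ : Respects d₂ j i' <;> simp [h₁, h₂]

open Classical in
/-- A diagram together with a power of the parameter is determined by its label counts. -/
lemma eq_of_counts {k : ℕ} {d d' : Diagram k} {a b : ℕ}
    (h : ∀ (α : Type) [Fintype α] (i i' : Fin k → α),
      Fintype.card α ^ a * (if Respects d i i' then 1 else 0) =
        Fintype.card α ^ b * (if Respects d' i i' then 1 else 0)) : d = d' ∧ a = b := by
  have key : ∀ (e e' : Diagram k) (a b : ℕ), (∀ (α : Type) [Fintype α] (i i' : Fin k → α),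
      Fintype.card α ^ a * (if Respects e i i' then 1 else 0) =
        Fintype.card α ^ b * (if Respects e' i i' then 1 else 0)) → e' ≤ e := by
    intro e e' a b h
    have : Fintype (Quotient e) := Fintype.ofFinite _
    have hl : ∀ x : Fin k ⊕ Fin k, Sum.elim (fun m => Quotient.mk e (Sum.inl m))
        (fun m => Quotient.mk e (Sum.inr m)) x = Quotient.mk e x := by
      rintro (x | x) <;> rfl
    have := h (Quotient e) (fun m => Quotient.mk e (Sum.inl m)) (fun m => Quotient.mk e (Sum.inr m))
    have hc : Respects e (fun m => Quotient.mk e (Sum.inl m))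
        (fun m => Quotient.mk e (Sum.inr m)) := by
      intro r s hrs
      rw [hl, hl]
      exact Quotient.sound hrs
    rw [if_pos hc] at this
    by_cases hr : Respects e' (fun m => Quotient.mk e (Sum.inl m))
        (fun m => Quotient.mk e (Sum.inr m))
    · intro x y hxy
      have h2 := hr x y hxy
      rw [hl, hl] at h2
      exact Quotient.exact h2
    · intro x y _
      rw [if_neg hr, mul_one, mul_zero] at this
      exact ((Fintype.card_eq_zero_iff.1 (eq_zero_of_pow_eq_zero this)).false
        (Quotient.mk e x)).elim
  refine ⟨le_antisymm (key d' d b a fun α _ i i' => (h α i i').symm) (key d d' a b h), ?_⟩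
  have hc := h Bool (fun _ => true) (fun _ => true)
  have ht : ∀ x : Fin k ⊕ Fin k, Sum.elim (fun _ => true) (fun _ => true) x = true := by
    rintro (x | x) <;> rfl
  have hr : ∀ e : Diagram k, Respects e (fun _ => true) (fun _ => true) := by
    intro e r s _
    rw [ht, ht]
  rw [if_pos (hr d), if_pos (hr d')] at hc
  simpa using hc


open Classical in
lemma comp_assoc_aux {k : ℕ} (d₁ d₂ d₃ : Diagram k) :
    comp (comp d₁ d₂) d₃ = comp d₁ (comp d₂ d₃) ∧
      numRemoved d₁ d₂ + numRemoved (comp d₁ d₂) d₃ =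
        numRemoved d₂ d₃ + numRemoved d₁ (comp d₂ d₃) := by
  apply eq_of_counts
  intro α _ i i'
  have e₁ : ∀ l : Fin k → α, Fintype.card α ^ numRemoved d₁ d₂ *
      ((if Respects (comp d₁ d₂) i l then 1 else 0) * (if Respects d₃ l i' then 1 else 0)) =
      ∑ j : Fin k → α, (if Respects d₁ i j then 1 else 0) *
        ((if Respects d₂ j l then 1 else 0) * (if Respects d₃ l i' then 1 else 0)) := by
    intro l
    rw [← mul_assoc, ← sum_middle, Finset.sum_mul]
    simp_rw [mul_assoc]
  have e₂ : ∀ j : Fin k → α, Fintype.card α ^ numRemoved d₂ d₃ *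
      ((if Respects d₁ i j then 1 else 0) * (if Respects (comp d₂ d₃) j i' then 1 else 0)) =
      ∑ l : Fin k → α, (if Respects d₁ i j then 1 else 0) *
        ((if Respects d₂ j l then 1 else 0) * (if Respects d₃ l i' then 1 else 0)) := by
    intro j
    rw [mul_left_comm, ← sum_middle, Finset.mul_sum]
  rw [pow_add, mul_assoc, ← sum_middle, pow_add, mul_assoc, ← sum_middle, Finset.mul_sum,
    Finset.mul_sum]
  simp_rw [e₁, e₂]
  exact Finset.sum_comm

lemma respects_id {k : ℕ} {α : Type*} (i i' : Fin k → α) :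
    Respects (idDiagram k) i i' ↔ i = i' := by
  constructor
  · intro h
    funext m
    exact h (Sum.inl m) (Sum.inr m) rfl
  · rintro rfl
    have : ∀ x : Fin k ⊕ Fin k, Sum.elim i i x = i (Sum.elim id id x) := by
      rintro (x | x) <;> rfl
    intro r s h
    rw [this, this]
    exact congrArg i h

lemma id_comp_aux {k : ℕ} (d : Diagram k) :
    comp (idDiagram k) d = d ∧ numRemoved (idDiagram k) d = 0 := by
  classical
  apply eq_of_counts
  intro α _ i i'
  rw [← sum_middle]
  simp only [respects_id, ite_mul, one_mul, zero_mul, pow_zero]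
  rw [Finset.sum_ite_eq Finset.univ i fun j => if Respects d j i' then 1 else 0]
  simp

lemma comp_id_aux {k : ℕ} (d : Diagram k) :
    comp d (idDiagram k) = d ∧ numRemoved d (idDiagram k) = 0 := by
  classical
  apply eq_of_counts
  intro α _ i i'
  rw [← sum_middle]
  simp only [respects_id, mul_ite, mul_one, mul_zero, pow_zero]
  rw [Finset.sum_ite_eq' Finset.univ i' fun j => if Respects d i j then 1 else 0]
  simp

instance {k : ℕ} : Finite (Diagram k) :=
  Finite.of_injective (fun d : Diagram k => (d.r : _ → _ → Prop)) fun _ _ h =>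
    Setoid.eq_iff_rel_eq.2 h

instance {k : ℕ} : Fintype (Diagram k) := Fintype.ofFinite _

/-! ### The partition algebras -/

/-- The partition algebra `ℂA_k(δ)`: the complex vector space with basis the set partitions `A_k`,
with the multiplication `d₁ d₂ = δ ^ ℓ (d₁ ∘ d₂)`. -/
def PartitionAlgebra (k : ℕ) (_δ : ℂ) : Type := Diagram k →₀ ℂ

namespace PartitionAlgebra

variable {k : ℕ} {δ : ℂ}

instance : AddCommGroup (PartitionAlgebra k δ) := inferInstanceAs (AddCommGroup (Diagram k →₀ ℂ))
instance : Module ℂ (PartitionAlgebra k δ) := inferInstanceAs (Module ℂ (Diagram k →₀ ℂ))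

variable (δ) in
/-- The basis of diagrams. -/
def basis (k : ℕ) : Module.Basis (Diagram k) ℂ (PartitionAlgebra k δ) :=
  Module.Basis.ofRepr (LinearEquiv.refl ℂ (Diagram k →₀ ℂ))

/-- The bilinear multiplication. -/
def mulMap (k : ℕ) (δ : ℂ) :
    PartitionAlgebra k δ →ₗ[ℂ] PartitionAlgebra k δ →ₗ[ℂ] PartitionAlgebra k δ :=
  (basis δ k).constr ℂ fun d₁ => (basis δ k).constr ℂ fun d₂ =>
    δ ^ numRemoved d₁ d₂ • basis δ k (comp d₁ d₂)

instance : Mul (PartitionAlgebra k δ) := ⟨fun a b => mulMap k δ a b⟩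
instance : One (PartitionAlgebra k δ) := ⟨basis δ k (idDiagram k)⟩

lemma mul_def (a b : PartitionAlgebra k δ) : a * b = mulMap k δ a b := rfl

lemma one_def : (1 : PartitionAlgebra k δ) = basis δ k (idDiagram k) := rfl

lemma basis_mul_basis (d₁ d₂ : Diagram k) :
    basis δ k d₁ * basis δ k d₂ = δ ^ numRemoved d₁ d₂ • basis δ k (comp d₁ d₂) := by
  rw [mul_def, mulMap, Module.Basis.constr_basis, Module.Basis.constr_basis]

@[elab_as_elim]
lemma induction {P : PartitionAlgebra k δ → Prop} (hb : ∀ d, P (basis δ k d))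
    (h0 : P 0) (ha : ∀ a b, P a → P b → P (a + b)) (hs : ∀ (c : ℂ) a, P a → P (c • a))
    (a : PartitionAlgebra k δ) : P a := by
  have : a ∈ Submodule.span ℂ (Set.range (basis δ k)) := (basis δ k).mem_span a
  induction this using Submodule.span_induction with
  | mem x h => obtain ⟨d, rfl⟩ := h; exact hb d
  | zero => exact h0
  | add x y _ _ hx hy => exact ha x y hx hy
  | smul c x _ hx => exact hs c x hx

lemma mulMap_assoc (a b c : PartitionAlgebra k δ) :
    mulMap k δ (mulMap k δ a b) c = mulMap k δ a (mulMap k δ b c) := by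
  induction a using induction with
  | h0 => simp
  | ha x y hx hy => simp only [map_add, LinearMap.add_apply, hx, hy]
  | hs t x hx => simp only [map_smul, LinearMap.smul_apply, hx]
  | hb d₁ =>
  induction b using induction with
  | h0 => simp
  | ha x y hx hy => simp only [map_add, LinearMap.add_apply, hx, hy]
  | hs t x hx => simp only [map_smul, LinearMap.smul_apply, hx]
  | hb d₂ =>
  induction c using induction with
  | h0 => simp
  | ha x y hx hy => simp only [map_add, hx, hy]
  | hs t x hx => simp only [map_smul, hx]
  | hb d₃ =>
  simp only [mulMap, Module.Basis.constr_basis, map_smul, LinearMap.smul_apply, smul_smul,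
    ← pow_add]
  rw [(comp_assoc_aux d₁ d₂ d₃).1, (comp_assoc_aux d₁ d₂ d₃).2]

lemma one_mulMap (a : PartitionAlgebra k δ) : mulMap k δ (basis δ k (idDiagram k)) a = a := by
  induction a using induction with
  | h0 => simp
  | ha x y hx hy => simp only [map_add, hx, hy]
  | hs t x hx => simp only [map_smul, hx]
  | hb d => rw [mulMap, Module.Basis.constr_basis, Module.Basis.constr_basis, (id_comp_aux d).1,
      (id_comp_aux d).2, pow_zero, one_smul]

lemma mulMap_one (a : PartitionAlgebra k δ) : mulMap k δ a (basis δ k (idDiagram k)) = a := by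
  induction a using induction with
  | h0 => simp
  | ha x y hx hy => simp only [map_add, LinearMap.add_apply, hx, hy]
  | hs t x hx => simp only [map_smul, LinearMap.smul_apply, hx]
  | hb d => rw [mulMap, Module.Basis.constr_basis, Module.Basis.constr_basis, (comp_id_aux d).1,
      (comp_id_aux d).2, pow_zero, one_smul]

instance : Ring (PartitionAlgebra k δ) where
  left_distrib a b c := map_add (mulMap k δ a) b c
  right_distrib a b c := LinearMap.map_add₂ (mulMap k δ) a b c
  zero_mul a := LinearMap.map_zero₂ (mulMap k δ) a
  mul_zero a := map_zero (mulMap k δ a)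
  mul_assoc := mulMap_assoc
  one_mul := one_mulMap
  mul_one := mulMap_one
  zsmul := fun m a => m • a
  zsmul_zero' := zero_zsmul
  zsmul_succ' := fun m a => by simp [add_zsmul]
  zsmul_neg' := fun m a => by
    simp [Int.negSucc_eq, add_zsmul]
  neg_add_cancel := neg_add_cancel
  sub_eq_add_neg := sub_eq_add_neg
  nsmul := fun m a => m • a
  nsmul_zero := zero_nsmul
  nsmul_succ := fun m a => succ_nsmul a m

instance : Algebra ℂ (PartitionAlgebra k δ) :=
  Algebra.ofModule (fun r x y => LinearMap.map_smul₂ (mulMap k δ) r x y)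
    (fun r x y => map_smul (mulMap k δ x) r y)

open Classical in
/-- The elements `x_d`, determined by the relation `d = ∑ x_{d'}`, the sum over all `d'` that are
coarser than or equal to `d`: recursively, `x_d = d - ∑ x_{d'}`, the sum over all `d'` that are
strictly coarser than `d`. -/
def orbitElement (k : ℕ) (δ : ℂ) (d : Diagram k) : PartitionAlgebra k δ :=
  basis δ k d - ∑ d' : {d' : Diagram k // d < d'}, orbitElement k δ d'.1
termination_by wellFounded_gt.wrap d
decreasing_by exact d'.2

open Classical in
lemma sum_le_eq {M : Type*} [AddCommMonoid M] (x : Diagram k → M) (d : Diagram k) :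
    ∑ d' with d ≤ d', x d' = x d + ∑ d' : {d' : Diagram k // d < d'}, x d'.1 := by
  rw [Finset.sum_subtype (Finset.univ.filter (d < ·)) (fun _ => by simp) x |>.symm,
    ← Finset.sum_insert (by simp)]
  congr 1
  ext e
  simp [le_iff_lt_or_eq, or_comm, eq_comm]

open Classical in
/-- The defining relation of the elements `x_d`. -/
theorem basis_eq_sum (d : Diagram k) :
    basis δ k d = ∑ d' with d ≤ d', orbitElement k δ d' := by
  rw [sum_le_eq, orbitElement, sub_add_cancel]

open Classical in
/-- The defining relation determines the elements `x_d`. -/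
theorem eq_orbitElement (x : Diagram k → PartitionAlgebra k δ)
    (hx : ∀ d, basis δ k d = ∑ d' with d ≤ d', x d') : x = orbitElement k δ := by
  funext d
  refine wellFounded_gt.induction (C := fun d => x d = orbitElement k δ d) d fun d ih => ?_
  have h : ∑ d' : {d' : Diagram k // d < d'}, x d'.1 =
      ∑ d' : {d' : Diagram k // d < d'}, orbitElement k δ d'.1 :=
    Finset.sum_congr rfl fun d' _ => ih d'.1 d'.2
  rw [orbitElement, hx d, sum_le_eq, h, add_sub_cancel_right]

end PartitionAlgebra

/-- The diagrams in `A_{k+1/2} ⊆ A_{k+1}`: those with `k+1` and `(k+1)'` in the same block. -/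
def IsHalf {k : ℕ} (d : Diagram (k + 1)) : Prop :=
  d (Sum.inl (Fin.last k)) (Sum.inr (Fin.last k))

lemma isHalf_comp {k : ℕ} {d₁ d₂ : Diagram (k + 1)} (h₁ : IsHalf d₁) (h₂ : IsHalf d₂) :
    IsHalf (comp d₁ d₂) :=
  (stack d₁ d₂).trans'
    (Relation.EqvGen.rel _ _ (Or.inl ⟨_, _, h₁, rfl, rfl⟩) :
      stack d₁ d₂ (Sum.inl (Fin.last k)) (Sum.inr (Sum.inl (Fin.last k))))
    (Relation.EqvGen.rel _ _ (Or.inr ⟨_, _, h₂, rfl, rfl⟩))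

open PartitionAlgebra

/-- The partition algebra `ℂA_{k+1/2}(δ)`, as the subalgebra of `ℂA_{k+1}(δ)` spanned by the
diagrams in `A_{k+1/2}`. -/
def HalfPartitionAlgebra (k : ℕ) (δ : ℂ) : Subalgebra ℂ (PartitionAlgebra (k + 1) δ) :=
  (Submodule.span ℂ (basis δ (k + 1) '' {d | IsHalf d})).toSubalgebra
    (Submodule.subset_span ⟨idDiagram (k + 1), rfl, rfl⟩)
    (by
      intro a b ha hb
      induction ha, hb using Submodule.span_induction₂ with
      | mem_mem x y hx hy =>
        obtain ⟨d₁, h₁, rfl⟩ := hx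
        obtain ⟨d₂, h₂, rfl⟩ := hy
        rw [basis_mul_basis]
        exact Submodule.smul_mem _ _ (Submodule.subset_span
          (Set.mem_image_of_mem _ (show comp d₁ d₂ ∈ {d | IsHalf d} from isHalf_comp h₁ h₂)))
      | zero_left y hy => simp
      | zero_right x hx => simp
      | add_left x y z _ _ _ h₁ h₂ => rw [add_mul]; exact Submodule.add_mem _ h₁ h₂
      | add_right x y z _ _ _ h₁ h₂ => rw [mul_add]; exact Submodule.add_mem _ h₁ h₂
      | smul_left r x y _ _ h => rw [smul_mul_assoc]; exact Submodule.smul_mem _ _ h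
      | smul_right r x y _ _ h => rw [mul_smul_comm]; exact Submodule.smul_mem _ _ h)

lemma mem_half_iff {k : ℕ} {δ : ℂ} {a : PartitionAlgebra (k + 1) δ} :
    a ∈ HalfPartitionAlgebra k δ ↔ a ∈ Submodule.span ℂ (basis δ (k + 1) '' {d | IsHalf d}) :=
  Iff.rfl

lemma orbitElement_mem_half {k : ℕ} (δ : ℂ) (d : Diagram (k + 1)) (hd : IsHalf d) :
    orbitElement (k + 1) δ d ∈ HalfPartitionAlgebra k δ := by
  revert hd
  refine wellFounded_gt.induction (C := fun d => IsHalf d →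
    orbitElement (k + 1) δ d ∈ HalfPartitionAlgebra k δ) d fun d ih hd => ?_
  rw [orbitElement]
  exact sub_mem (Submodule.subset_span ⟨d, hd, rfl⟩)
    (sum_mem fun d' _ => ih d'.1 d'.2 (d'.2.le hd))

/-- The elements `x_d` of `ℂA_{k+1/2}(δ)`, for `d` in `A_{k+1/2}`.  They are the same as in
`ℂA_{k+1}(δ)`, since all `d'` that are coarser than `d` are again in `A_{k+1/2}`. -/
def halfOrbitElement (k : ℕ) (δ : ℂ) (d : {d : Diagram (k + 1) // IsHalf d}) :
    HalfPartitionAlgebra k δ :=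
  ⟨orbitElement (k + 1) δ d.1, orbitElement_mem_half δ d.1 d.2⟩

/-! ### The actions on tensor space -/

section Action

variable {n : ℕ} {V : Type*} [AddCommGroup V] [Module ℂ V] (v : Module.Basis (Fin n) ℂ V)

/-- The basis `v_{i_1} ⊗ ⋯ ⊗ v_{i_k}` of `V^{⊗k}`. -/
def tensorBasis (k : ℕ) : Module.Basis (Fin k → Fin n) ℂ (⨂[ℂ]^k V) :=
  Basis.piTensorProduct fun _ => v

lemma tensorBasis_apply (k : ℕ) (i : Fin k → Fin n) :
    tensorBasis v k i = ⨂ₜ[ℂ] r, v (i r) := by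
  simp [tensorBasis]

open Classical in
/-- The matrix entry `(d)^{i_1, …, i_k}_{i_1', …, i_k'}`. -/
def entry {k : ℕ} (d : Diagram k) (i i' : Fin k → Fin n) : ℂ := if Respects d i i' then 1 else 0

lemma sum_entry {k : ℕ} (d₁ d₂ : Diagram k) (i i' : Fin k → Fin n) :
    ∑ j, entry d₁ i j * entry d₂ j i' = (n : ℂ) ^ numRemoved d₁ d₂ * entry (comp d₁ d₂) i i' := by
  have := congrArg (Nat.cast : ℕ → ℂ) (sum_middle d₁ d₂ i i')
  simpa [entry] using this

/-- The endomorphism of `V^{⊗k}` by which a diagram acts: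
`d(v_{i_1} ⊗ ⋯ ⊗ v_{i_k}) = ∑ (d)^{i_1, …, i_k}_{i_1', …, i_k'} v_{i_1'} ⊗ ⋯ ⊗ v_{i_k'}`. -/
def diagramEnd {k : ℕ} (d : Diagram k) : Module.End ℂ (⨂[ℂ]^k V) :=
  (tensorBasis v k).constr ℂ fun i => ∑ i', entry d i i' • tensorBasis v k i'

lemma diagramEnd_apply {k : ℕ} (d : Diagram k) (i : Fin k → Fin n) :
    diagramEnd v d (tensorBasis v k i) = ∑ i', entry d i i' • tensorBasis v k i' :=
  Module.Basis.constr_basis _ _ _ _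

lemma diagramEnd_mul {k : ℕ} (d₁ d₂ : Diagram k) :
    diagramEnd v d₂ * diagramEnd v d₁ =
      (n : ℂ) ^ numRemoved d₁ d₂ • diagramEnd v (comp d₁ d₂) := by
  refine (tensorBasis v k).ext fun i => ?_
  rw [Module.End.mul_apply, LinearMap.smul_apply, diagramEnd_apply, diagramEnd_apply, map_sum]
  simp_rw [map_smul, diagramEnd_apply, Finset.smul_sum, smul_smul, ← sum_entry, Finset.sum_smul]
  exact Finset.sum_comm

lemma diagramEnd_id (k : ℕ) : diagramEnd v (idDiagram k) = 1 := by
  classical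
  refine (tensorBasis v k).ext fun i => ?_
  simp [diagramEnd_apply, entry, respects_id]

/-- The linear extension of `diagramEnd` to `ℂA_k(n)`. -/
def actionMap (k : ℕ) : PartitionAlgebra k (n : ℂ) →ₗ[ℂ] (Module.End ℂ (⨂[ℂ]^k V))ᵐᵒᵖ :=
  (basis (n : ℂ) k).constr ℂ fun d => MulOpposite.op (diagramEnd v d)

lemma actionMap_basis {k : ℕ} (d : Diagram k) :
    actionMap v k (basis (n : ℂ) k d) = MulOpposite.op (diagramEnd v d) :=
  Module.Basis.constr_basis _ _ _ _

/-- The action `Φ_k` of `ℂA_k(n)` on `V^{⊗k}`.  As `d₁ d₂` is formed by placing `d₁` above `d₂` and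
operators map the labels of the top row to those of the bottom row, this is a right action, that
is, an algebra homomorphism to the opposite of the endomorphism algebra. -/
def action (k : ℕ) : PartitionAlgebra k (n : ℂ) →ₐ[ℂ] (Module.End ℂ (⨂[ℂ]^k V))ᵐᵒᵖ :=
  AlgHom.ofLinearMap
    (actionMap v k)
    (by rw [one_def, actionMap_basis, diagramEnd_id, MulOpposite.op_one])
    (by
      intro a b
      induction a using PartitionAlgebra.induction with
      | h0 => simp
      | ha x y hx hy => simp only [add_mul, map_add, hx, hy]
      | hs t x hx => simp only [smul_mul_assoc, map_smul, hx]
      | hb d₁ =>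
      induction b using PartitionAlgebra.induction with
      | h0 => simp
      | ha x y hx hy => simp only [mul_add, map_add, hx, hy]
      | hs t x hx => simp only [mul_smul_comm, map_smul, hx]
      | hb d₂ =>
      rw [basis_mul_basis, map_smul, actionMap_basis, actionMap_basis, actionMap_basis,
        ← MulOpposite.op_mul, diagramEnd_mul, MulOpposite.op_smul])

lemma action_basis {k : ℕ} (d : Diagram k) :
    action v k (basis (n : ℂ) k d) = MulOpposite.op (diagramEnd v d) :=
  actionMap_basis v d

/-- The embedding `V^{⊗k} → V^{⊗(k+1)}`, `w ↦ w ⊗ v_m`. -/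
def appendVec (m : Fin n) (k : ℕ) : (⨂[ℂ]^k V) →ₗ[ℂ] ⨂[ℂ]^(k + 1) V :=
  (tensorBasis v k).constr ℂ fun i => tensorBasis v (k + 1) (Fin.snoc i m)

lemma appendVec_apply (m : Fin n) (k : ℕ) (i : Fin k → Fin n) :
    appendVec v m k (tensorBasis v k i) = tensorBasis v (k + 1) (Fin.snoc i m) :=
  Module.Basis.constr_basis _ _ _ _

open Classical in
/-- The left inverse of `w ↦ w ⊗ v_m` that kills the other basis vectors of `V^{⊗(k+1)}`. -/
def dropVec (m : Fin n) (k : ℕ) : (⨂[ℂ]^(k + 1) V) →ₗ[ℂ] ⨂[ℂ]^k V :=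
  (tensorBasis v (k + 1)).constr ℂ fun i =>
    if i (Fin.last k) = m then tensorBasis v k (Fin.init i) else 0

lemma dropVec_apply (m : Fin n) (k : ℕ) (i : Fin (k + 1) → Fin n) :
    dropVec v m k (tensorBasis v (k + 1) i) =
      if i (Fin.last k) = m then tensorBasis v k (Fin.init i) else 0 := by
  rw [dropVec, Module.Basis.constr_basis]

lemma dropVec_appendVec (m : Fin n) (k : ℕ) (w : ⨂[ℂ]^k V) :
    dropVec v m k (appendVec v m k w) = w := by
  have : dropVec v m k ∘ₗ appendVec v m k = LinearMap.id := by
    refine (tensorBasis v k).ext fun i => ?_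
    simp [appendVec_apply, dropVec_apply]
  exact LinearMap.congr_fun this w

/-- The subspace `V^{⊗k} ⊗ v_m` is stable under `ℂA_{k+1/2}(n)`. -/
lemma action_appendVec_mem (m : Fin n) (k : ℕ) {a : PartitionAlgebra (k + 1) (n : ℂ)}
    (ha : a ∈ HalfPartitionAlgebra k (n : ℂ)) (w : ⨂[ℂ]^k V) :
    (action v (k + 1) a).unop (appendVec v m k w) ∈ LinearMap.range (appendVec v m k) := by
  rw [mem_half_iff] at ha
  induction ha using Submodule.span_induction with
  | zero => simp
  | add x y _ _ hx hy =>
    rw [map_add, MulOpposite.unop_add, LinearMap.add_apply]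
    exact add_mem hx hy
  | smul c x _ hx =>
    rw [map_smul, MulOpposite.unop_smul, LinearMap.smul_apply]
    exact Submodule.smul_mem _ c hx
  | mem x hx =>
    obtain ⟨d, hd, rfl⟩ := hx
    rw [action_basis, MulOpposite.unop_op]
    have hw : w ∈ Submodule.span ℂ (Set.range (tensorBasis v k)) := (tensorBasis v k).mem_span w
    induction hw using Submodule.span_induction with
    | zero => simp
    | add x y _ _ hx hy => rw [map_add, map_add]; exact add_mem hx hy
    | smul c x _ hx => rw [map_smul, map_smul]; exact Submodule.smul_mem _ c hx
    | mem x hx =>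
      obtain ⟨i, rfl⟩ := hx
      rw [appendVec_apply, diagramEnd_apply]
      refine Submodule.sum_mem _ fun j _ => ?_
      rw [entry]
      split_ifs with h
      · have hj : m = j (Fin.last k) := by simpa using h _ _ hd
        refine Submodule.smul_mem _ _ ⟨tensorBasis v k (Fin.init j), ?_⟩
        rw [appendVec_apply, hj, Fin.snoc_init_self]
      · simp

lemma appendVec_dropVec (m : Fin n) (k : ℕ) {a : PartitionAlgebra (k + 1) (n : ℂ)}
    (ha : a ∈ HalfPartitionAlgebra k (n : ℂ)) (w : ⨂[ℂ]^k V) :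
    appendVec v m k (dropVec v m k ((action v (k + 1) a).unop (appendVec v m k w))) =
      (action v (k + 1) a).unop (appendVec v m k w) := by
  obtain ⟨u, hu⟩ := action_appendVec_mem v m k ha w
  rw [← hu, dropVec_appendVec]

/-- The index `n` of the last basis vector `v_n`. -/
def lastIndex (hn : 0 < n) : Fin n := ⟨n - 1, Nat.sub_lt hn Nat.one_pos⟩

/-- The action `Φ_{k+1/2}` of `ℂA_{k+1/2}(n)` on `V^{⊗k}`: the restriction of `Φ_{k+1}` to the
stable subspace `V^{⊗k} ⊗ v_n`, which is identified with `V^{⊗k}`. -/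
def halfAction (hn : 0 < n) (k : ℕ) :
    HalfPartitionAlgebra k (n : ℂ) →ₐ[ℂ] (Module.End ℂ (⨂[ℂ]^k V))ᵐᵒᵖ where
  toFun a := MulOpposite.op
    (dropVec v (lastIndex hn) k ∘ₗ (action v (k + 1) a.1).unop ∘ₗ appendVec v (lastIndex hn) k)
  map_one' := by
    apply MulOpposite.unop_injective
    refine LinearMap.ext fun w => ?_
    simp [dropVec_appendVec]
  map_mul' a b := by
    apply MulOpposite.unop_injective
    refine LinearMap.ext fun w => ?_
    simp [appendVec_dropVec v _ k a.2]
  map_zero' := by simp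
  map_add' a b := by
    apply MulOpposite.unop_injective
    refine LinearMap.ext fun w => ?_
    simp
  commutes' r := by
    apply MulOpposite.unop_injective
    refine LinearMap.ext fun w => ?_
    simp [Algebra.algebraMap_eq_smul_one, dropVec_appendVec]

/-- `Φ_{k+1/2}(a)` corresponds to `Φ_{k+1}(a)` under `w ↦ w ⊗ v_n`. -/
lemma appendVec_halfAction (hn : 0 < n) (k : ℕ) (a : HalfPartitionAlgebra k (n : ℂ))
    (w : ⨂[ℂ]^k V) :
    appendVec v (lastIndex hn) k ((halfAction v hn k a).unop w) =
      (action v (k + 1) a.1).unop (appendVec v (lastIndex hn) k w) :=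
  appendVec_dropVec v _ k a.2 w

/-- The action of a permutation `σ` on `V^{⊗k}`: `v_{i_1} ⊗ ⋯ ⊗ v_{i_k} ↦
v_{σ(i_1)} ⊗ ⋯ ⊗ v_{σ(i_k)}`, the tensor power of the permutation matrix of `σ`. -/
def permAction (k : ℕ) (σ : Equiv.Perm (Fin n)) : Module.End ℂ (⨂[ℂ]^k V) :=
  PiTensorProduct.map fun _ => (v.equiv v σ).toLinearMap

lemma permAction_apply (k : ℕ) (σ : Equiv.Perm (Fin n)) (i : Fin k → Fin n) :
    permAction v k σ (tensorBasis v k i) = tensorBasis v k (σ ∘ i) := by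
  simp [permAction, tensorBasis_apply]

/-- The centralizer algebra `End_G(V^{⊗k})` of a group `G` of permutations. -/
def equivariantEnd (k : ℕ) (G : Subgroup (Equiv.Perm (Fin n))) :
    Subalgebra ℂ (Module.End ℂ (⨂[ℂ]^k V)) where
  carrier := {b | ∀ σ ∈ G, ∀ w, b (permAction v k σ w) = permAction v k σ (b w)}
  mul_mem' {a b} ha hb σ hσ w := by
    rw [Module.End.mul_apply, hb σ hσ, ha σ hσ, Module.End.mul_apply]
  add_mem' {a b} ha hb σ hσ w := by
    rw [LinearMap.add_apply, hb σ hσ, ha σ hσ, LinearMap.add_apply, map_add]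
  algebraMap_mem' r σ _ w := by simp

end Action

end PartAlg
end

open PartAlg

/-!
Expand an endomorphism of `V^{⊗k}` in its matrix entries, which are indexed by pairs `(i, i')` of
labellings of the top and of the bottom row by `{1, …, n}`.  Such a pair has a kernel, the set
partition whose blocks are the sets of equally labelled vertices, and a diagram `d` acts with entry
`1` at `(i, i')` exactly if the kernel of `(i, i')` is coarser than `d`.  Since `d` is the sum of
the `x_{d'}` over all coarser `d'`, this says that the entry of `Φ_k(a)` at `(i, i')` is the
coefficient of `a` at `x_d`, where `d` is the kernel of `(i, i')` (`repr_action`).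

Hence the image of `Φ_k` consists of the endomorphisms whose entries depend on the kernel only, and
the kernel of `Φ_k` is spanned by the `x_d` for which `d` is not the kernel of any labelling
(`mem_range_iff_of_repr_eq`, `ker_eq_of_repr_eq`).  Two labellings with the same kernel differ by a
permutation of the labels (`exists_perm_comp_eq`), so the first condition is `S_n`-equivariance; and
a set partition is the kernel of a labelling if and only if it has at most `n` blocks
(`exists_ker_eq_iff`).

The half-integer case is the same with the labellings in which the last vertex of both rows is
labelled `n`: a permutation that relates two such labellings fixes `n`.
-/

namespace PartAlg

open PartitionAlgebra

/-! ### Linear maps described by coefficients -/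

section Coefficients

variable {ι D W A : Type*} [AddCommGroup W] [Module ℂ W] [AddCommGroup A] [Module ℂ A]
  (B : Module.Basis ι ℂ W) (X : Module.Basis D ℂ A) (L : A →ₗ[ℂ] Module.End ℂ W) (K : ι → ι → D)

/-- If the entry of `L a` at `(i, j)` is the coefficient of `a` at `K i j`, then the image of `L`
consists of the endomorphisms whose entries are constant on the fibres of `K`. -/
lemma mem_range_iff_of_repr_eq [Finite D]
    (hL : ∀ a i j, B.repr (L a (B i)) j = X.repr a (K i j))
    (f : Module.End ℂ W) :
    f ∈ LinearMap.range L ↔ ∀ i j i' j', K i j = K i' j' →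
      B.repr (f (B i)) j = B.repr (f (B i')) j' := by
  classical
  constructor
  · rintro ⟨a, rfl⟩ i j i' j' h
    rw [hL, hL, h]
  · intro h
    -- A value of `K` receives the common entry on its fibre, everything else the coefficient `0`.
    let c : D → ℂ := fun d => if hd : ∃ p : ι × ι, K p.1 p.2 = d then
      B.repr (f (B hd.choose.1)) hd.choose.2 else 0
    refine ⟨X.repr.symm (Finsupp.equivFunOnFinite.symm c), B.ext fun i => B.ext_elem fun j => ?_⟩
    have hd : ∃ p : ι × ι, K p.1 p.2 = K i j := ⟨(i, j), rfl⟩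
    rw [hL, LinearEquiv.apply_symm_apply, Finsupp.coe_equivFunOnFinite_symm]
    simp only [c, dif_pos hd]
    exact h _ _ _ _ hd.choose_spec

/-- If the entry of `L a` at `(i, j)` is the coefficient of `a` at `K i j`, then the kernel of `L`
is spanned by the basis vectors at the indices which are not values of `K`. -/
lemma ker_eq_of_repr_eq (hL : ∀ a i j, B.repr (L a (B i)) j = X.repr a (K i j)) :
    LinearMap.ker L = Submodule.span ℂ (X '' {d | ¬ ∃ i j, K i j = d}) := by
  ext a
  rw [X.mem_span_image, LinearMap.mem_ker]
  constructor
  · rintro h d hd ⟨i, j, rfl⟩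
    refine Finsupp.mem_support_iff.1 hd ?_
    rw [← hL, h]
    simp
  · intro h
    refine B.ext fun i => B.ext_elem fun j => ?_
    rw [hL, LinearMap.zero_apply, map_zero, Finsupp.zero_apply]
    by_contra hne
    exact h (Finsupp.mem_support_iff.2 hne) ⟨i, j, rfl⟩

end Coefficients

/-! ### Labellings and their kernels -/

/-- Labellings with the same kernel differ by a permutation of the labels. -/
lemma exists_perm_comp_eq {P α : Type*} [Finite α] {x y : P → α}
    (h : Setoid.ker x = Setoid.ker y) : ∃ σ : Equiv.Perm α, ∀ p, σ (x p) = y p := by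
  classical
  have : Fintype α := Fintype.ofFinite α
  let e : {a // a ∈ Set.range x} ≃ {a // a ∈ Set.range y} :=
    (Setoid.quotientKerEquivRange x).symm.trans
      ((Quotient.congrRight fun a b => by rw [h]).trans (Setoid.quotientKerEquivRange y))
  refine ⟨e.extendSubtype, fun p => ?_⟩
  rw [Equiv.extendSubtype_apply_of_mem e _ ⟨p, rfl⟩]
  have hp : (Setoid.quotientKerEquivRange x).symm ⟨x p, p, rfl⟩ = Quotient.mk _ p := by
    rw [Equiv.symm_apply_eq]
    rfl
  simp only [e, Equiv.trans_apply, hp]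
  rfl

/-- An equivalence relation is the kernel of a labelling by `n` labels if and only if it has at
most `n` classes. -/
lemma exists_ker_eq_iff {P : Type*} [Finite P] {n : ℕ} (d : Setoid P) :
    (∃ x : P → Fin n, Setoid.ker x = d) ↔ Nat.card (Quotient d) ≤ n := by
  constructor
  · rintro ⟨x, rfl⟩
    rw [Nat.card_congr (Setoid.quotientKerEquivRange x)]
    exact (Nat.card_le_card_of_injective _ Subtype.val_injective).trans_eq (Nat.card_fin n)
  · intro h
    let e : Quotient d ↪ Fin n :=
      ((Finite.equivFin (Quotient d)).toEmbedding).trans (Fin.castLEEmb h)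
    refine ⟨fun q => e (Quotient.mk d q), Setoid.ext fun a b => ?_⟩
    rw [Setoid.ker_def, e.injective.eq_iff, Quotient.eq]

/-- For a labelling with a given kernel one may prescribe the label of one element. -/
lemma exists_ker_eq_and_apply_eq_iff {P α : Type*} (d : Setoid P) (p : P) (m : α) :
    (∃ x : P → α, Setoid.ker x = d ∧ x p = m) ↔ ∃ x : P → α, Setoid.ker x = d := by
  classical
  constructor
  · rintro ⟨x, hx, -⟩
    exact ⟨x, hx⟩
  · rintro ⟨x, rfl⟩
    refine ⟨Equiv.swap (x p) m ∘ x, Setoid.ext fun a b => ?_, Equiv.swap_apply_left _ _⟩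
    rw [Setoid.ker_def, Setoid.ker_def]
    exact (Equiv.swap (x p) m).injective.eq_iff

/-- The set partition of the vertices into the sets of equally labelled ones, for the labelling
`i` of the top and `i'` of the bottom row. -/
abbrev labelKer {k : ℕ} {α : Type*} (i i' : Fin k → α) : Diagram k := Setoid.ker (Sum.elim i i')

lemma respects_iff_le_labelKer {k : ℕ} {α : Type*} (d : Diagram k) (i i' : Fin k → α) :
    Respects d i i' ↔ d ≤ labelKer i i' :=
  ⟨fun h r s hrs => h r s hrs, fun h _ _ hrs => h hrs⟩

lemma exists_labelKer_eq_iff {k n : ℕ} (d : Diagram k) :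
    (∃ i i' : Fin k → Fin n, labelKer i i' = d) ↔ d.numBlocks ≤ n := by
  rw [Diagram.numBlocks, ← exists_ker_eq_iff]
  constructor
  · rintro ⟨i, i', h⟩
    exact ⟨_, h⟩
  · rintro ⟨x, h⟩
    exact ⟨x ∘ Sum.inl, x ∘ Sum.inr, by rw [labelKer, Sum.elim_comp_inl_inr, h]⟩

lemma labelKer_perm_comp {k : ℕ} {α : Type*} (σ : Equiv.Perm α) (i i' : Fin k → α) :
    labelKer (σ ∘ i) (σ ∘ i') = labelKer i i' := by
  refine Setoid.ext fun a b => ?_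
  rw [labelKer, labelKer, ← Sum.comp_elim, Setoid.ker_def, Setoid.ker_def]
  exact σ.injective.eq_iff

lemma exists_perm_of_labelKer_eq {k : ℕ} {α : Type*} [Finite α] {i i' j j' : Fin k → α}
    (h : labelKer i j = labelKer i' j') :
    ∃ σ : Equiv.Perm α, σ ∘ i = i' ∧ σ ∘ j = j' := by
  obtain ⟨σ, hσ⟩ := exists_perm_comp_eq h
  exact ⟨σ, funext fun r => hσ (Sum.inl r), funext fun r => hσ (Sum.inr r)⟩

/-- The kernel of a labelling of two rows of `k + 1` vertices, where the last vertex of both rows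
has the label `m`. -/
def halfLabelKer {k : ℕ} {α : Type*} (m : α) (i i' : Fin k → α) :
    {d : Diagram (k + 1) // IsHalf d} :=
  ⟨labelKer (Fin.snoc i m) (Fin.snoc i' m), by
    change Fin.snoc (α := fun _ => α) i m (Fin.last k) = Fin.snoc (α := fun _ => α) i' m _
    rw [Fin.snoc_last, Fin.snoc_last]⟩

lemma exists_halfLabelKer_eq_iff {k n : ℕ} (m : Fin n) (d : {d : Diagram (k + 1) // IsHalf d}) :
    (∃ i i' : Fin k → Fin n, halfLabelKer m i i' = d) ↔ Diagram.numBlocks d.1 ≤ n := by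
  rw [Diagram.numBlocks, ← exists_ker_eq_iff,
    ← exists_ker_eq_and_apply_eq_iff d.1 (Sum.inl (Fin.last k)) m]
  constructor
  · rintro ⟨i, i', rfl⟩
    exact ⟨_, rfl, by simp⟩
  · rintro ⟨x, h, hx⟩
    have hx' : x (Sum.inr (Fin.last k)) = m := by
      have hd := d.2
      rw [IsHalf, ← h, Setoid.ker_def, hx] at hd
      exact hd.symm
    refine ⟨Fin.init (x ∘ Sum.inl), Fin.init (x ∘ Sum.inr), Subtype.ext ?_⟩
    have h₁ : Fin.snoc (Fin.init (x ∘ Sum.inl)) m = x ∘ Sum.inl := by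
      rw [← hx]
      exact Fin.snoc_init_self (α := fun _ => Fin n) (x ∘ Sum.inl)
    have h₂ : Fin.snoc (Fin.init (x ∘ Sum.inr)) m = x ∘ Sum.inr := by
      rw [← hx']
      exact Fin.snoc_init_self (α := fun _ => Fin n) (x ∘ Sum.inr)
    change labelKer (Fin.snoc (Fin.init (x ∘ Sum.inl)) m) (Fin.snoc (Fin.init (x ∘ Sum.inr)) m) = _
    rw [h₁, h₂, labelKer, Sum.elim_comp_inl_inr, h]

lemma snoc_perm_comp {k : ℕ} {α : Type*} {σ : Equiv.Perm α} {m : α} (hσ : σ m = m)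
    (i : Fin k → α) :
    (Fin.snoc (σ ∘ i) m : Fin (k + 1) → α) = σ ∘ (Fin.snoc i m : Fin (k + 1) → α) := by
  rw [Fin.comp_snoc, hσ]

lemma halfLabelKer_perm_comp {k : ℕ} {α : Type*} {σ : Equiv.Perm α} {m : α} (hσ : σ m = m)
    (i i' : Fin k → α) : halfLabelKer m (σ ∘ i) (σ ∘ i') = halfLabelKer m i i' := by
  apply Subtype.ext
  change labelKer (Fin.snoc (σ ∘ i) m) (Fin.snoc (σ ∘ i') m) = labelKer _ _
  rw [snoc_perm_comp hσ, snoc_perm_comp hσ, labelKer_perm_comp]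

lemma exists_perm_of_halfLabelKer_eq {k : ℕ} {α : Type*} [Finite α] {m : α}
    {i i' j j' : Fin k → α} (h : halfLabelKer m i j = halfLabelKer m i' j') :
    ∃ σ : Equiv.Perm α, σ m = m ∧ σ ∘ i = i' ∧ σ ∘ j = j' := by
  obtain ⟨σ, h₁, h₂⟩ := exists_perm_of_labelKer_eq (congrArg Subtype.val h)
  refine ⟨σ, by simpa using congrFun h₁ (Fin.last k), funext fun r => ?_, funext fun r => ?_⟩
  · simpa using congrFun h₁ r.castSucc
  · simpa using congrFun h₂ r.castSucc

/-! ### The bases of orbit elements -/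

lemma span_range_orbitElement (k : ℕ) (δ : ℂ) :
    Submodule.span ℂ (Set.range (orbitElement k δ)) = ⊤ := by
  classical
  rw [eq_top_iff, ← (basis δ k).span_eq, Submodule.span_le]
  rintro _ ⟨d, rfl⟩
  rw [basis_eq_sum]
  exact Submodule.sum_mem _ fun d' _ => Submodule.subset_span ⟨d', rfl⟩

/-- The basis of `ℂA_k(δ)` that consists of the elements `x_d`. -/
noncomputable def orbitBasis (k : ℕ) (δ : ℂ) : Module.Basis (Diagram k) ℂ (PartitionAlgebra k δ) :=
  basisOfTopLeSpanOfCardEqFinrank (orbitElement k δ) (span_range_orbitElement k δ).ge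
    (Module.finrank_eq_card_basis (basis δ k)).symm

lemma orbitBasis_apply (k : ℕ) (δ : ℂ) (d : Diagram k) :
    orbitBasis k δ d = orbitElement k δ d := by
  rw [orbitBasis, coe_basisOfTopLeSpanOfCardEqFinrank]

open Classical in
lemma orbitBasis_repr_basis {k : ℕ} {δ : ℂ} (d e : Diagram k) :
    (orbitBasis k δ).repr (basis δ k d) e = if d ≤ e then 1 else 0 := by
  simp_rw [basis_eq_sum, ← orbitBasis_apply, map_sum, Module.Basis.repr_self,
    Finsupp.finsetSum_apply, Finsupp.single_apply]
  simp

lemma linearIndependent_halfOrbitElement (k : ℕ) (δ : ℂ) :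
    LinearIndependent ℂ (halfOrbitElement k δ) := by
  refine LinearIndependent.of_comp (HalfPartitionAlgebra k δ).val.toLinearMap ?_
  have := (orbitBasis (k + 1) δ).linearIndependent.comp
    (Subtype.val : {d : Diagram (k + 1) // IsHalf d} → _) Subtype.val_injective
  have h : (HalfPartitionAlgebra k δ).val.toLinearMap ∘ halfOrbitElement k δ =
      orbitBasis (k + 1) δ ∘ Subtype.val := funext fun d => (orbitBasis_apply _ _ _).symm
  rw [h]
  exact this

lemma top_le_span_range_halfOrbitElement (k : ℕ) (δ : ℂ) :
    ⊤ ≤ Submodule.span ℂ (Set.range (halfOrbitElement k δ)) := by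
  classical
  rintro ⟨a, ha⟩ -
  have key : (HalfPartitionAlgebra k δ).toSubmodule ≤
      (Submodule.span ℂ (Set.range (halfOrbitElement k δ))).map
        (HalfPartitionAlgebra k δ).val.toLinearMap := by
    refine Submodule.span_le.2 ?_
    rintro _ ⟨d, hd, rfl⟩
    rw [basis_eq_sum]
    refine Submodule.sum_mem _ fun d' hd' => ?_
    have hd' : IsHalf d' := (Finset.mem_filter.1 hd').2 hd
    exact ⟨halfOrbitElement k δ ⟨d', hd'⟩, Submodule.subset_span ⟨_, rfl⟩, rfl⟩
  obtain ⟨b, hb, hba⟩ := key ha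
  rwa [show (⟨a, ha⟩ : HalfPartitionAlgebra k δ) = b from Subtype.ext hba.symm]

/-- The basis of `ℂA_{k+1/2}(δ)` that consists of the elements `x_d`. -/
noncomputable def halfOrbitBasis (k : ℕ) (δ : ℂ) :
    Module.Basis {d : Diagram (k + 1) // IsHalf d} ℂ (HalfPartitionAlgebra k δ) :=
  Module.Basis.mk (linearIndependent_halfOrbitElement k δ) (top_le_span_range_halfOrbitElement k δ)

lemma halfOrbitBasis_apply (k : ℕ) (δ : ℂ) (d : {d : Diagram (k + 1) // IsHalf d}) :
    halfOrbitBasis k δ d = halfOrbitElement k δ d :=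
  Module.Basis.mk_apply _ _ _

lemma orbitBasis_repr_coe {k : ℕ} {δ : ℂ} (a : HalfPartitionAlgebra k δ)
    (d : {d : Diagram (k + 1) // IsHalf d}) :
    (orbitBasis (k + 1) δ).repr a.1 d.1 = (halfOrbitBasis k δ).repr a d := by
  have : (orbitBasis (k + 1) δ).coord d.1 ∘ₗ (HalfPartitionAlgebra k δ).val.toLinearMap =
      (halfOrbitBasis k δ).coord d := by
    classical
    refine (halfOrbitBasis k δ).ext fun e => ?_
    have he : (HalfPartitionAlgebra k δ).val.toLinearMap (halfOrbitBasis k δ e) =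
        orbitBasis (k + 1) δ e.1 := by
      rw [halfOrbitBasis_apply, orbitBasis_apply]
      rfl
    rw [LinearMap.comp_apply, he, Module.Basis.coord_apply, Module.Basis.coord_apply,
      Module.Basis.repr_self, Module.Basis.repr_self, Finsupp.single_apply, Finsupp.single_apply]
    exact if_congr Subtype.ext_iff.symm rfl rfl
  exact LinearMap.congr_fun this a

/-! ### Matrix entries on tensor space -/

section Entries

variable {n : ℕ} {V : Type*} [AddCommGroup V] [Module ℂ V] (v : Module.Basis (Fin n) ℂ V)

/-- The entries of `Φ_k(a)` are the coefficients of `a` in the basis of the elements `x_d`. -/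
lemma repr_action {k : ℕ} (a : PartitionAlgebra k (n : ℂ)) (i i' : Fin k → Fin n) :
    (tensorBasis v k).repr ((action v k a).unop (tensorBasis v k i)) i' =
      (orbitBasis k (n : ℂ)).repr a (labelKer i i') := by
  classical
  induction a using PartitionAlgebra.induction with
  | h0 => simp
  | ha x y hx hy =>
    simp only [map_add, MulOpposite.unop_add, LinearMap.add_apply, Finsupp.add_apply, hx, hy]
  | hs c x hx =>
    simp only [map_smul, MulOpposite.unop_smul, LinearMap.smul_apply, Finsupp.smul_apply, hx]
  | hb d =>
    rw [orbitBasis_repr_basis, action_basis, MulOpposite.unop_op, diagramEnd_apply,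
      Module.Basis.repr_sum_self, entry]
    exact if_congr (respects_iff_le_labelKer d i i') rfl rfl

lemma repr_dropVec (m : Fin n) (k : ℕ) (w : ⨂[ℂ]^(k + 1) V) (i : Fin k → Fin n) :
    (tensorBasis v k).repr (dropVec v m k w) i =
      (tensorBasis v (k + 1)).repr w (Fin.snoc i m) := by
  classical
  have : (tensorBasis v k).coord i ∘ₗ dropVec v m k =
      (tensorBasis v (k + 1)).coord (Fin.snoc i m) := by
    refine (tensorBasis v (k + 1)).ext fun j => ?_
    rw [LinearMap.comp_apply, dropVec_apply, Module.Basis.coord_apply, Module.Basis.coord_apply,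
      Module.Basis.repr_self, Finsupp.single_apply]
    split_ifs with h₁ h₂ h₂
    · rw [h₂, Fin.init_snoc, Module.Basis.repr_self, Finsupp.single_eq_same]
    · rw [Module.Basis.repr_self, Finsupp.single_eq_of_ne]
      rintro rfl
      exact h₂ (by rw [← h₁, Fin.snoc_init_self])
    · exact absurd (by rw [h₂, Fin.snoc_last]) h₁
    · simp
  exact LinearMap.congr_fun this w

lemma repr_halfAction (hn : 0 < n) {k : ℕ} (a : HalfPartitionAlgebra k (n : ℂ))
    (i i' : Fin k → Fin n) :
    (tensorBasis v k).repr ((halfAction v hn k a).unop (tensorBasis v k i)) i' =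
      (halfOrbitBasis k (n : ℂ)).repr a (halfLabelKer (lastIndex hn) i i') := by
  rw [← orbitBasis_repr_coe, halfLabelKer, ← repr_action v, ← appendVec_apply, ← repr_dropVec]
  rfl

lemma repr_permAction {k : ℕ} (σ : Equiv.Perm (Fin n)) (w : ⨂[ℂ]^k V) (i : Fin k → Fin n) :
    (tensorBasis v k).repr (permAction v k σ w) (σ ∘ i) = (tensorBasis v k).repr w i := by
  classical
  have : (tensorBasis v k).coord (σ ∘ i) ∘ₗ permAction v k σ = (tensorBasis v k).coord i := by
    refine (tensorBasis v k).ext fun j => ?_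
    rw [LinearMap.comp_apply, permAction_apply, Module.Basis.coord_apply, Module.Basis.coord_apply,
      Module.Basis.repr_self, Module.Basis.repr_self, Finsupp.single_apply, Finsupp.single_apply]
    exact if_congr (σ.injective.comp_left.eq_iff) rfl rfl
  exact LinearMap.congr_fun this w

/-- An endomorphism is equivariant if and only if its entries are invariant under simultaneous
permutation of the labels. -/
lemma mem_equivariantEnd_iff {k : ℕ} {G : Subgroup (Equiv.Perm (Fin n))}
    {f : Module.End ℂ (⨂[ℂ]^k V)} :
    f ∈ equivariantEnd v k G ↔ ∀ σ ∈ G, ∀ i j : Fin k → Fin n,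
      (tensorBasis v k).repr (f (tensorBasis v k (σ ∘ i))) (σ ∘ j) =
        (tensorBasis v k).repr (f (tensorBasis v k i)) j := by
  constructor
  · intro h σ hσ i j
    rw [← permAction_apply, h σ hσ, repr_permAction]
  · intro h σ hσ w
    have : f ∘ₗ permAction v k σ = permAction v k σ ∘ₗ f := by
      refine (tensorBasis v k).ext fun i => (tensorBasis v k).ext_elem fun j => ?_
      have hj : j = σ ∘ (σ.symm ∘ j) := by
        funext r
        simp
      rw [hj, LinearMap.comp_apply, LinearMap.comp_apply, permAction_apply, h σ hσ,
        repr_permAction]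
    exact LinearMap.congr_fun this w

/-- Image and kernel of an algebra homomorphism to `End(V^{⊗k})ᵒᵖ` whose entries are the
coefficients at `K i j`, where the fibres of `K` are the orbits of `G` on pairs of labellings. -/
lemma range_and_ker_of_repr_eq {k : ℕ} {A D : Type*} [Ring A] [Algebra ℂ A] [Finite D]
    (X : Module.Basis D ℂ A) (Φ : A →ₐ[ℂ] (Module.End ℂ (⨂[ℂ]^k V))ᵐᵒᵖ)
    (K : (Fin k → Fin n) → (Fin k → Fin n) → D) (G : Subgroup (Equiv.Perm (Fin n)))
    (hΦ : ∀ a i j, (tensorBasis v k).repr ((Φ a).unop (tensorBasis v k i)) j = X.repr a (K i j))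
    (hK : ∀ i j i' j', K i j = K i' j' ↔ ∃ σ ∈ G, σ ∘ i = i' ∧ σ ∘ j = j') :
    Φ.range = (equivariantEnd v k G).op ∧
      LinearMap.ker Φ.toLinearMap = Submodule.span ℂ (X '' {d | ¬ ∃ i j, K i j = d}) := by
  let L : A →ₗ[ℂ] Module.End ℂ (⨂[ℂ]^k V) :=
    (MulOpposite.opLinearEquiv ℂ).symm.toLinearMap ∘ₗ Φ.toLinearMap
  constructor
  · ext f
    have hf : f ∈ Φ.range ↔ f.unop ∈ LinearMap.range L :=
      exists_congr fun a => MulOpposite.unop_injective.eq_iff.symm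
    rw [hf, mem_range_iff_of_repr_eq _ X L K hΦ, Subalgebra.mem_op, mem_equivariantEnd_iff]
    constructor
    · intro h σ hσ i j
      exact (h _ _ _ _ ((hK _ _ _ _).2 ⟨σ, hσ, rfl, rfl⟩)).symm
    · intro h i j i' j' hij
      obtain ⟨σ, hσ, rfl, rfl⟩ := (hK _ _ _ _).1 hij
      exact (h σ hσ i j).symm
  · rw [← ker_eq_of_repr_eq _ X L K hΦ]
    exact (LinearEquiv.ker_comp _ _).symm

end Entries

end PartAlg

open PartAlg
theorem theorem3p6 {n : ℕ} (hn : 0 < n) (k : ℕ)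
    {V : Type*} [AddCommGroup V] [Module ℂ V] (v : Module.Basis (Fin n) ℂ V) :
    ((action v k).range = (equivariantEnd v k ⊤).op ∧
      LinearMap.ker (action v k).toLinearMap =
        Submodule.span ℂ {a | ∃ d : Diagram k, n < d.numBlocks ∧
          a = PartitionAlgebra.orbitElement k (n : ℂ) d}) ∧
    ((halfAction v hn k).range =
        (equivariantEnd v k (MulAction.stabilizer (Equiv.Perm (Fin n)) (lastIndex hn))).op ∧
      LinearMap.ker (halfAction v hn k).toLinearMap =
        Submodule.span ℂ {a | ∃ d : {d : Diagram (k + 1) // IsHalf d},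
          n < Diagram.numBlocks d.1 ∧ a = halfOrbitElement k (n : ℂ) d}) := by
  have hfull := range_and_ker_of_repr_eq v (orbitBasis k (n : ℂ)) (action v k) labelKer ⊤
    (repr_action v) fun i j i' j' => by
      constructor
      · intro h
        obtain ⟨σ, hσ⟩ := exists_perm_of_labelKer_eq h
        exact ⟨σ, Subgroup.mem_top σ, hσ⟩
      · rintro ⟨σ, -, rfl, rfl⟩
        exact (labelKer_perm_comp σ i j).symm
  have hhalf := range_and_ker_of_repr_eq v (halfOrbitBasis k (n : ℂ)) (halfAction v hn k)
    (halfLabelKer (lastIndex hn)) (MulAction.stabilizer (Equiv.Perm (Fin n)) (lastIndex hn))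
    (repr_halfAction v hn) fun i j i' j' => by
      constructor
      · intro h
        obtain ⟨σ, hσ, h⟩ := exists_perm_of_halfLabelKer_eq h
        exact ⟨σ, hσ, h⟩
      · rintro ⟨σ, hσ, rfl, rfl⟩
        exact (halfLabelKer_perm_comp hσ i j).symm
  refine ⟨⟨hfull.1, hfull.2.trans (congrArg _ ?_)⟩, hhalf.1, hhalf.2.trans (congrArg _ ?_)⟩
  · ext a
    refine exists_congr fun d => ?_
    rw [Set.mem_ofPred_eq, exists_labelKer_eq_iff, not_le, orbitBasis_apply, eq_comm (b := a)]
  · ext a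
    refine exists_congr fun d => ?_
    rw [Set.mem_ofPred_eq, exists_halfLabelKer_eq_iff, not_le, halfOrbitBasis_apply,
      eq_comm (b := a)]
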